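/- For a finite simple graph $G$ with at least two vertices let $d(G)=|E(G)|/\binom{|V(G)|}{2}$. For nonempty disjoint $A,B\subseteq V(G)$ let $d(A,B)=|E(A,B)|/(|A||B|)$, where $E(A,B)$ is the set of edges with one endpoint in $A$ and the other in $B$. The pair $(A,B)$ is $\varepsilon$-regular if $|d(X,Y)-d(A,B)|\le\varepsilon$ for all $X\subseteq A$, $Y\subseteq B$ with $|X|\ge\varepsilon|A|$ and $|Y|\ge\varepsilon|B|$. Let $G$ be a graph on $n\ge 2$ vertices with $d(G)>0$. Then for every real $0<\varepsilon\le d(G)/2$ and every integer $r$ with $1\le r\le n$ there exist pairwise disjoint sets $W_1,\dots,W_r\subseteq V(G)$ such that (1) $|W_i|\ge \varepsilon^{r^2/\varepsilon^5}\,\dfrac{n}{r}$ for every $i=1,\dots,r$; (2) the pair $(W_i,W_j)$ is $\varepsilon$-regular for all $1\le i<j\le r$; and (3) if $r\ge 2$, the graph $R$ with vertex set $\{W_1,\dots,W_r\}$, in which $W_i$ and $W_j$ ($i\ne j$) are adjacent if and only if $d(W_i,W_j)\ge \dfrac{d(G)}{4-d(G)}$, satisfies $d(R)\ge \dfrac{d(G)}{4}$.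 -/

import Mathlib

/-- The density of a finite graph: the number of its edges divided by the number of pairs of
vertices (meaningful when there are at least two vertices). -/
noncomputable def graphDensity {V : Type*} [Fintype V] (G : SimpleGraph V) : ℝ :=
  (G.edgeSet.ncard : ℝ) / ((Fintype.card V).choose 2 : ℝ)

/-- The pair `(A, B)` is `ε`-regular: subsets `X ⊆ A`, `Y ⊆ B` with `|X| ≥ ε |A|` and
`|Y| ≥ ε |B|` satisfy `|d(X, Y) - d(A, B)| ≤ ε`. (The inequality `≤ ε` is not strict, unlike
in `SimpleGraph.IsUniform`.) Here `G.edgeDensity A B = |E(A, B)| / (|A| |B|)`. -/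
def IsRegularPair {V : Type*} (G : SimpleGraph V) [DecidableRel G.Adj] (ε : ℝ)
    (A B : Finset V) : Prop :=
  ∀ X ⊆ A, ∀ Y ⊆ B, ε * (A.card : ℝ) ≤ (X.card : ℝ) → ε * (B.card : ℝ) ≤ (Y.card : ℝ) →
    |(G.edgeDensity X Y : ℝ) - (G.edgeDensity A B : ℝ)| ≤ ε

/-- The box `W 0 × ⋯ × W (r - 1)` is `ε`-regular: all its pairs of sides are. -/
def IsRegularBox {V : Type*} (G : SimpleGraph V) [DecidableRel G.Adj] (ε : ℝ) {r : ℕ}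
    (W : Fin r → Finset V) : Prop :=
  ∀ i j : Fin r, i < j → IsRegularPair G ε (W i) (W j)

/-- The graph `R(W, δ)` with the sides of the box `W` as vertices (represented by their indices),
two different sides being adjacent if the density of the pair is at least `δ`. -/
def reducedGraph {V : Type*} (G : SimpleGraph V) [DecidableRel G.Adj] {r : ℕ}
    (W : Fin r → Finset V) (δ : ℝ) : SimpleGraph (Fin r) where
  Adj i j := i ≠ j ∧ δ ≤ (G.edgeDensity (W i) (W j) : ℝ)
  symm := ⟨fun i j h => ⟨h.1.symm, by rw [SimpleGraph.edgeDensity_comm]; exact h.2⟩⟩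
  loopless := ⟨fun _ h => h.1 rfl⟩

/-! Start from `r` disjoint sets of size `⌊n/r⌋` whose average pair density is at least `d = d(G)`;
a random placement gives this on average (`exists_box_le_sum_pairMean`). Follow the potential `∑ (p
+ c p²)` over the `K = r(r-1)` ordered pairs of sides, `p` being the density and `c = d/2`. If a
pair is irregular, cut its two sides along witnesses and choose a part of each with probability
proportional to size: the linear terms keep their means and the squares gain a variance, so some
choice raises the potential by `2cε⁴ = dε⁴ ≥ 2ε⁵` (`exists_cut_boxPotential`), each side keeping at
least an `ε²` fraction.

The potential starts at `Kd` or more and never exceeds `K + Kd/2`, so a regular box appears within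
about `K/(2ε⁵)` steps. The squares contribute at most `Kd/2`, so the final average density is still
at least `d/2`; this forces a dense reduced graph (`graphDensity_reducedGraph_ge`). -/

/-! ### Densities as means. -/

/-- The mean of `f` over `A ×ˢ B`. -/
noncomputable def pairMean {V : Type*} (f : V → V → ℝ) (A B : Finset V) : ℝ :=
  (∑ a ∈ A, ∑ b ∈ B, f a b) / ((A.card : ℝ) * (B.card : ℝ))

/-- The indicator function of adjacency. -/
def adjInd {V : Type*} (G : SimpleGraph V) [DecidableRel G.Adj] (a b : V) : ℝ :=
  if G.Adj a b then 1 else 0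

theorem edgeDensity_eq_pairMean {V : Type*} (G : SimpleGraph V) [DecidableRel G.Adj]
    (A B : Finset V) : (G.edgeDensity A B : ℝ) = pairMean (adjInd G) A B := by
  unfold pairMean adjInd
  rw [SimpleGraph.edgeDensity_def, SimpleGraph.interedges_def, ← Finset.sum_product',
    Finset.sum_boole]
  push_cast
  rfl

theorem pairMean_neg {V : Type*} (f : V → V → ℝ) (A B : Finset V) :
    pairMean (fun a b => -f a b) A B = -pairMean f A B := by
  simp [pairMean, Finset.sum_neg_distrib, neg_div]

theorem pairMean_swap {V : Type*} (f : V → V → ℝ) (A B : Finset V) :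
    pairMean (fun a b => f b a) A B = pairMean f B A := by
  unfold pairMean
  rw [Finset.sum_comm, mul_comm]

/-- Holds for empty `A` too, so cuts with an empty part need no separate treatment. -/
theorem card_mul_pairMean {V : Type*} (f : V → V → ℝ) (A B : Finset V) :
    (A.card : ℝ) * pairMean f A B = (∑ a ∈ A, ∑ b ∈ B, f a b) / (B.card : ℝ) := by
  rcases A.eq_empty_or_nonempty with rfl | hA
  · simp
  · have : (A.card : ℝ) ≠ 0 := by exact_mod_cast hA.card_pos.ne'
    unfold pairMean
    rw [← mul_div_assoc, mul_div_mul_left _ _ this]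

theorem pairMean_split {V : Type*} [DecidableEq V] (f : V → V → ℝ) {A X : Finset V}
    (C : Finset V) (hA : A.Nonempty) (hX : X ⊆ A) :
    (X.card : ℝ) / A.card * pairMean f X C + ((A \ X).card : ℝ) / A.card * pairMean f (A \ X) C
      = pairMean f A C := by
  have : (A.card : ℝ) ≠ 0 := by exact_mod_cast hA.card_pos.ne'
  have e := card_mul_pairMean f A C
  rw [div_mul_eq_mul_div, div_mul_eq_mul_div, ← add_div, card_mul_pairMean, card_mul_pairMean,
    ← add_div, add_comm, Finset.sum_sdiff hX, ← e]
  field_simp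

/-! ### Small witnesses of irregularity. -/

/-- Deleting a point where `f` is least does not lower the mean. -/
theorem exists_subset_card_eq_mean_le {V : Type*} [DecidableEq V] (f : V → ℝ) (X : Finset V)
    {k : ℕ} (hk : 1 ≤ k) (hkX : k ≤ X.card) :
    ∃ X' ⊆ X, X'.card = k ∧ (∑ x ∈ X, f x) / X.card ≤ (∑ x ∈ X', f x) / X'.card := by
  induction hn : X.card - k generalizing X with
  | zero => exact ⟨X, subset_rfl, by omega, le_rfl⟩
  | succ n ih =>
    have hne : X.Nonempty := Finset.card_pos.mp (by omega)
    obtain ⟨x, hx, hmin⟩ := X.exists_min_image f hne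
    have hc := Finset.card_erase_of_mem hx
    obtain ⟨X', hX', hcard, hle⟩ := ih (X.erase x) (by omega) (by omega)
    refine ⟨X', hX'.trans (X.erase_subset x), hcard, le_trans ?_ hle⟩
    have hs := Finset.add_sum_erase X f hx
    have hbound : ((X.erase x).card : ℝ) * f x ≤ ∑ y ∈ X.erase x, f y := by
      rw [← nsmul_eq_mul]
      exact Finset.card_nsmul_le_sum _ _ _ fun y hy => hmin y (Finset.mem_of_mem_erase hy)
    have hcR : (X.card : ℝ) = (X.erase x).card + 1 := by
      have : X.card = (X.erase x).card + 1 := by omega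
      exact_mod_cast this
    have hpos : (0 : ℝ) < (X.erase x).card := by
      have : 0 < (X.erase x).card := by omega
      exact_mod_cast this
    rw [← hs, hcR, div_le_div_iff₀ (by positivity) hpos]
    nlinarith

theorem exists_subset_card_eq_pairMean_le {V : Type*} [DecidableEq V] (f : V → V → ℝ)
    (X Y : Finset V) {k : ℕ} (hk : 1 ≤ k) (hkX : k ≤ X.card) :
    ∃ X' ⊆ X, X'.card = k ∧ pairMean f X Y ≤ pairMean f X' Y := by
  obtain ⟨X', h1, h2, h3⟩ :=
    exists_subset_card_eq_mean_le (fun x => ∑ y ∈ Y, f x y) X hk hkX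
  refine ⟨X', h1, h2, ?_⟩
  unfold pairMean
  rw [← div_div, ← div_div]
  gcongr

theorem exists_subsets_card_eq_pairMean_le {V : Type*} [DecidableEq V] (f : V → V → ℝ)
    (X Y : Finset V) {k l : ℕ} (hk : 1 ≤ k) (hkX : k ≤ X.card) (hl : 1 ≤ l) (hlY : l ≤ Y.card) :
    ∃ X' ⊆ X, ∃ Y' ⊆ Y, X'.card = k ∧ Y'.card = l ∧ pairMean f X Y ≤ pairMean f X' Y' := by
  obtain ⟨X', h1, h2, h3⟩ := exists_subset_card_eq_pairMean_le f X Y hk hkX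
  obtain ⟨Y', h4, h5, h6⟩ :=
    exists_subset_card_eq_pairMean_le (fun a b => f b a) Y X' hl hlY
  rw [pairMean_swap f Y X', pairMean_swap f Y' X'] at h6
  exact ⟨X', h1, Y', h4, h2, h5, h3.trans h6⟩

/-- The witnesses of irregularity can be taken as small as the definition permits. -/
theorem exists_small_witness {V : Type*} [DecidableEq V] (G : SimpleGraph V) [DecidableRel G.Adj]
    {ε : ℝ} (hε : 0 < ε) {A B : Finset V} (hA : A.Nonempty) (hB : B.Nonempty)
    (h : ¬ IsRegularPair G ε A B) :
    ∃ X ⊆ A, ∃ Y ⊆ B, X.card = ⌈ε * A.card⌉₊ ∧ Y.card = ⌈ε * B.card⌉₊ ∧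
      ε < |pairMean (adjInd G) X Y - pairMean (adjInd G) A B| := by
  unfold IsRegularPair at h
  push Not at h
  obtain ⟨X, hX, Y, hY, hXc, hYc, hlt⟩ := h
  rw [edgeDensity_eq_pairMean, edgeDensity_eq_pairMean] at hlt
  have hApos : (0 : ℝ) < A.card := by exact_mod_cast hA.card_pos
  have hBpos : (0 : ℝ) < B.card := by exact_mod_cast hB.card_pos
  have hk : 1 ≤ ⌈ε * A.card⌉₊ := Nat.ceil_pos.mpr (by positivity)
  have hl : 1 ≤ ⌈ε * B.card⌉₊ := Nat.ceil_pos.mpr (by positivity)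
  have hkX : ⌈ε * A.card⌉₊ ≤ X.card := Nat.ceil_le.mpr hXc
  have hlY : ⌈ε * B.card⌉₊ ≤ Y.card := Nat.ceil_le.mpr hYc
  rcases lt_abs.mp hlt with h | h
  · obtain ⟨X', h1, Y', h2, h3, h4, h5⟩ :=
      exists_subsets_card_eq_pairMean_le (adjInd G) X Y hk hkX hl hlY
    exact ⟨X', h1.trans hX, Y', h2.trans hY, h3, h4, lt_abs.mpr (Or.inl (by linarith))⟩
  -- A downward deviation is an upward one for the negated indicator.
  · obtain ⟨X', h1, Y', h2, h3, h4, h5⟩ :=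
      exists_subsets_card_eq_pairMean_le (fun a b => -adjInd G a b) X Y hk hkX hl hlY
    rw [pairMean_neg, pairMean_neg] at h5
    exact ⟨X', h1.trans hX, Y', h2.trans hY, h3, h4, lt_abs.mpr (Or.inr (by linarith))⟩

/-! ### Cutting the sides of a box. -/

/-- `X` and its complement in `A`, indexed by `Bool`. -/
def cut {V : Type*} [DecidableEq V] (A X : Finset V) (b : Bool) : Finset V :=
  if b then X else A \ X

theorem cut_subset {V : Type*} [DecidableEq V] {A X : Finset V} (hX : X ⊆ A) (b : Bool) :
    cut A X b ⊆ A := by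
  cases b
  · exact Finset.sdiff_subset
  · exact hX

/-- The exact size of `X` leaves the complement more than `|A|/2 - 1` points; being nonempty it has
at least one, so by averaging more than `|A|/4 ≥ ε²|A|`. -/
theorem sq_mul_card_le_card_cut {V : Type*} [DecidableEq V] {ε : ℝ} (hε : 0 < ε) (hε2 : ε ≤ 1 / 2)
    {A X : Finset V} (hX : X ⊆ A) (hc : X.card = ⌈ε * A.card⌉₊) (b : Bool)
    (hne : (cut A X b).Nonempty) : ε ^ 2 * (A.card : ℝ) ≤ ((cut A X b).card : ℝ) := by
  have hA0 : (0 : ℝ) ≤ A.card := by positivity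
  cases b with
  | true =>
    have : ε * A.card ≤ (X.card : ℝ) := by rw [hc]; exact Nat.le_ceil _
    change _ ≤ (X.card : ℝ)
    nlinarith [mul_nonneg hε.le hA0]
  | false =>
    change (A \ X).Nonempty at hne
    change _ ≤ ((A \ X).card : ℝ)
    have h1 : ((A \ X).card : ℝ) = A.card - X.card := by
      rw [Finset.card_sdiff_of_subset hX, Nat.cast_sub (Finset.card_le_card hX)]
    have h2 : (1 : ℝ) ≤ (A \ X).card := by exact_mod_cast hne.card_pos
    have h3 : (X.card : ℝ) < ε * A.card + 1 := by rw [hc]; exact Nat.ceil_lt_add_one (by positivity)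
    have h4 : ε * A.card ≤ 1 / 2 * A.card := by gcongr
    have h5 : ε ^ 2 * A.card ≤ 1 / 2 * (1 / 2 * A.card) := by
      rw [pow_two, mul_assoc]
      exact mul_le_mul hε2 h4 (by positivity) (by norm_num)
    linarith

/-- The mean of `F` over the two boxes got from `W` by replacing its side `W i` by `X` and by
`W i \ X`. -/
noncomputable def splitMean {V : Type*} [DecidableEq V] {r : ℕ} (W : Fin r → Finset V) (i : Fin r)
    (X : Finset V) (F : (Fin r → Finset V) → ℝ) : ℝ :=
  ∑ b : Bool, ((cut (W i) X b).card : ℝ) / (W i).card * F (Function.update W i (cut (W i) X b))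

theorem splitMean_pairMean {V : Type*} [DecidableEq V] {r : ℕ} (f : V → V → ℝ)
    (W : Fin r → Finset V) {i k l : Fin r} {X : Finset V} (hX : X ⊆ W i) (hW : (W i).Nonempty)
    (hkl : k ≠ l) :
    splitMean W i X (fun U => pairMean f (U k) (U l)) = pairMean f (W k) (W l) := by
  unfold splitMean
  rw [Fintype.sum_bool]
  simp only [cut, if_true, Bool.false_eq_true, if_false]
  by_cases hk : k = i
  · subst hk
    simp only [Function.update_self, Function.update_of_ne hkl.symm]
    exact pairMean_split f _ hW hX
  · by_cases hl : l = i
    · subst hl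
      simp only [Function.update_self, Function.update_of_ne hkl]
      rw [← pairMean_swap f X, ← pairMean_swap f (W l \ X), ← pairMean_swap f (W l)]
      exact pairMean_split (fun a b => f b a) _ hW hX
    · simp only [Function.update_of_ne hk, Function.update_of_ne hl]
      rw [← add_mul, ← add_div, add_comm, ← Nat.cast_add, Finset.card_sdiff_add_card_eq_card hX,
        div_self (by exact_mod_cast hW.card_pos.ne'), one_mul]

theorem sum_card_cut_div {V : Type*} [DecidableEq V] {A X : Finset V} (hX : X ⊆ A)
    (hA : A.Nonempty) : ∑ b : Bool, ((cut A X b).card : ℝ) / A.card = 1 := by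
  rw [Fintype.sum_bool]
  simp only [cut, if_true, Bool.false_eq_true, if_false]
  rw [← add_div, add_comm, ← Nat.cast_add, Finset.card_sdiff_add_card_eq_card hX,
    div_self (by exact_mod_cast hA.card_pos.ne')]

theorem sum_mul_sq_eq {ι : Type*} [Fintype ι] (p x : ι → ℝ) {d : ℝ} (hp : ∑ q, p q = 1)
    (hd : ∑ q, p q * x q = d) :
    ∑ q, p q * x q ^ 2 = d ^ 2 + ∑ q, p q * (x q - d) ^ 2 := by
  have : ∑ q, p q * (x q - d) ^ 2
      = ∑ q, p q * x q ^ 2 - 2 * d * ∑ q, p q * x q + d ^ 2 * ∑ q, p q := by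
    rw [Finset.mul_sum, Finset.mul_sum, ← Finset.sum_sub_distrib, ← Finset.sum_add_distrib]
    exact Finset.sum_congr rfl fun q _ => by ring
  rw [this, hp, hd]
  ring

/-- Positive weight of the chosen index will make the chosen parts nonempty. -/
theorem exists_le_of_le_weighted_mean {ι : Type*} [Fintype ι] (p x : ι → ℝ) {y : ℝ}
    (hp0 : ∀ q, 0 ≤ p q) (hp : ∑ q, p q = 1) (h : y ≤ ∑ q, p q * x q) :
    ∃ q, 0 < p q ∧ y ≤ x q := by
  by_contra! hcon
  have hle : ∀ q, p q * x q ≤ p q * y := fun q => by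
    rcases (hp0 q).eq_or_lt with h0 | h0
    · simp [← h0]
    · exact mul_le_mul_of_nonneg_left (hcon q h0).le h0.le
  obtain ⟨q, -, hq⟩ : ∃ q ∈ Finset.univ, p q ≠ 0 :=
    Finset.exists_ne_zero_of_sum_ne_zero (by rw [hp]; exact one_ne_zero)
  have hq0 : 0 < p q := lt_of_le_of_ne (hp0 q) hq.symm
  have : ∑ q, p q * x q < ∑ q, p q * y :=
    Finset.sum_lt_sum (fun q _ => hle q)
      ⟨q, Finset.mem_univ q, mul_lt_mul_of_pos_left (hcon q hq0) hq0⟩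
  rw [← Finset.sum_mul, hp, one_mul] at this
  linarith

/-! ### The potential increment. -/

/-- The potential of a box: densities of ordered pairs of sides plus `c` times their squares. -/
noncomputable def boxPotential {V : Type*} (G : SimpleGraph V) [DecidableRel G.Adj] (c : ℝ) {r : ℕ}
    (W : Fin r → Finset V) : ℝ :=
  ∑ e ∈ (Finset.univ : Finset (Fin r)).offDiag,
    (pairMean (adjInd G) (W e.1) (W e.2) + c * pairMean (adjInd G) (W e.1) (W e.2) ^ 2)

theorem exists_cut_boxPotential {V : Type*} [DecidableEq V] (G : SimpleGraph V) [DecidableRel G.Adj]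
    {ε c : ℝ} (hε : 0 < ε) (hc : 0 ≤ c) {r : ℕ} (W : Fin r → Finset V) (hW : ∀ i, (W i).Nonempty)
    {i j : Fin r} (hij : i ≠ j) {X Y : Finset V} (hX : X ⊆ W i) (hY : Y ⊆ W j)
    (hXc : ε * (W i).card ≤ X.card) (hYc : ε * (W j).card ≤ Y.card)
    (hdev : ε < |pairMean (adjInd G) X Y - pairMean (adjInd G) (W i) (W j)|) :
    ∃ s t : Bool, (cut (W i) X s).Nonempty ∧ (cut (W j) Y t).Nonempty ∧
      boxPotential G c W + 2 * c * ε ^ 4 ≤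
        boxPotential G c
          (Function.update (Function.update W i (cut (W i) X s)) j (cut (W j) Y t)) := by
  -- The probability that independent uniform points of `W i` and `W j` fall into the parts named by
  -- `q`.
  set p : Bool × Bool → ℝ := fun q =>
    ((cut (W i) X q.1).card : ℝ) / (W i).card * (((cut (W j) Y q.2).card : ℝ) / (W j).card) with hp
  set U : Bool × Bool → Fin r → Finset V := fun q =>
    Function.update (Function.update W i (cut (W i) X q.1)) j (cut (W j) Y q.2) with hU
  have hp0 : ∀ q, 0 ≤ p q := fun q => by positivity
  have hp1 : ∑ q, p q = 1 := by
    rw [Fintype.sum_prod_type]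
    simp only [hp, ← Finset.mul_sum]
    rw [sum_card_cut_div hY (hW j)]
    simp only [mul_one]
    exact sum_card_cut_div hX (hW i)
  have hmean : ∀ k l : Fin r, k ≠ l →
      ∑ q, p q * pairMean (adjInd G) (U q k) (U q l) = pairMean (adjInd G) (W k) (W l) := by
    intro k l hkl
    rw [← splitMean_pairMean (adjInd G) W hX (hW i) hkl, Fintype.sum_prod_type]
    unfold splitMean
    refine Finset.sum_congr rfl fun s _ => ?_
    have hj : Function.update W i (cut (W i) X s) j = W j := Function.update_of_ne hij.symm _ _
    beta_reduce
    rw [← splitMean_pairMean (adjInd G) (Function.update W i (cut (W i) X s)) (i := j) (X := Y)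
      (by rwa [hj]) (by rw [hj]; exact hW j) hkl]
    unfold splitMean
    rw [hj, Finset.mul_sum]
    exact Finset.sum_congr rfl fun t _ => by simp only [hp, hU]; ring
  have hsq := fun (k l : Fin r) (hkl : k ≠ l) =>
    sum_mul_sq_eq p (fun q => pairMean (adjInd G) (U q k) (U q l)) hp1 (hmean k l hkl)
  set v : Fin r × Fin r → ℝ := fun e => ∑ q, p q *
    (pairMean (adjInd G) (U q e.1) (U q e.2) - pairMean (adjInd G) (W e.1) (W e.2)) ^ 2 with hv
  have hv0 : ∀ e, 0 ≤ v e := fun e =>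
    Finset.sum_nonneg fun q _ => mul_nonneg (hp0 q) (sq_nonneg _)
  have hsym : ∀ A B : Finset V, pairMean (adjInd G) A B = pairMean (adjInd G) B A := fun A B => by
    rw [← pairMean_swap]
    congr 1
    funext a b
    simp only [adjInd, G.adj_comm]
  -- The outcome `(X, Y)` alone suffices: probability at least `ε²`, squared deviation at least
  -- `ε²`.
  have hvij : ε ^ 4 ≤ v (i, j) := by
    have hpos : ∀ k, (0 : ℝ) < (W k).card := fun k => by exact_mod_cast (hW k).card_pos
    have h1 : ε ≤ (X.card : ℝ) / (W i).card := (le_div_iff₀ (hpos i)).mpr hXc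
    have h2 : ε ≤ (Y.card : ℝ) / (W j).card := (le_div_iff₀ (hpos j)).mpr hYc
    have h3 : ε ^ 2 ≤ (pairMean (adjInd G) X Y - pairMean (adjInd G) (W i) (W j)) ^ 2 := by
      rw [← sq_abs (pairMean _ _ _ - _)]
      gcongr
    have h4 : p (true, true) * (pairMean (adjInd G) (U (true, true) i) (U (true, true) j)
        - pairMean (adjInd G) (W i) (W j)) ^ 2 ≤ v (i, j) :=
      Finset.single_le_sum (f := fun q => p q * (pairMean (adjInd G) (U q i) (U q j)
        - pairMean (adjInd G) (W i) (W j)) ^ 2)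
        (fun q _ => mul_nonneg (hp0 q) (sq_nonneg _)) (Finset.mem_univ _)
    have h5 : U (true, true) i = X := by simp [hU, hij, cut]
    have h6 : U (true, true) j = Y := by simp [hU, cut]
    rw [h5, h6] at h4
    refine le_trans ?_ h4
    calc ε ^ 4 = ε * ε * ε ^ 2 := by ring
      _ ≤ _ := mul_le_mul (mul_le_mul h1 h2 hε.le (by positivity)) h3 (by positivity) (by positivity)
  -- The pair counts in both orders, whence the factor 2 in the gain.
  have hvji : v (j, i) = v (i, j) := by
    simp only [hv]
    exact Finset.sum_congr rfl fun q _ => by rw [hsym (U q j), hsym (W j)]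
  have htot : boxPotential G c W + 2 * c * ε ^ 4 ≤ ∑ q, p q * boxPotential G c (U q) := by
    have h1 : ∑ q, p q * boxPotential G c (U q)
        = boxPotential G c W + c * ∑ e ∈ (Finset.univ : Finset (Fin r)).offDiag, v e := by
      unfold boxPotential
      simp_rw [Finset.mul_sum]
      rw [Finset.sum_comm, ← Finset.sum_add_distrib]
      refine Finset.sum_congr rfl fun e he => ?_
      have hne : e.1 ≠ e.2 := (Finset.mem_offDiag.mp he).2.2
      have h2 := hsq e.1 e.2 hne
      have h3 := hmean e.1 e.2 hne
      calc _ = ∑ q, p q * pairMean (adjInd G) (U q e.1) (U q e.2)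
            + c * ∑ q, p q * pairMean (adjInd G) (U q e.1) (U q e.2) ^ 2 := by
              rw [Finset.mul_sum, ← Finset.sum_add_distrib]
              exact Finset.sum_congr rfl fun q _ => by ring
        _ = _ := by rw [h2, h3]; simp only [hv]; ring
    have h2 : v (i, j) + v (j, i) ≤ ∑ e ∈ (Finset.univ : Finset (Fin r)).offDiag, v e := by
      rw [← Finset.sum_pair (f := v) (a := (i, j)) (b := (j, i)) (by simp [hij])]
      refine Finset.sum_le_sum_of_subset_of_nonneg ?_ fun e _ _ => hv0 e
      intro e he
      simp only [Finset.mem_insert, Finset.mem_singleton] at he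
      rcases he with rfl | rfl
      · simp [hij]
      · simp [hij.symm]
    rw [h1]
    nlinarith
  obtain ⟨q, hq, hle⟩ := exists_le_of_le_weighted_mean p (fun q => boxPotential G c (U q)) hp0 hp1 htot
  refine ⟨q.1, q.2, ?_, ?_, hle⟩
  · by_contra hne
    simp [hp, Finset.not_nonempty_iff_eq_empty.mp hne] at hq
  · by_contra hne
    simp [hp, Finset.not_nonempty_iff_eq_empty.mp hne] at hq

/-- An irregular box contains a box of larger potential. -/
theorem exists_subbox_of_not_regular {V : Type*} [DecidableEq V] (G : SimpleGraph V)
    [DecidableRel G.Adj] {ε c : ℝ} (hε : 0 < ε) (hε2 : ε ≤ 1 / 2) (hc : 0 ≤ c) {r : ℕ}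
    (W : Fin r → Finset V) (hW : ∀ i, (W i).Nonempty) (h : ¬ IsRegularBox G ε W) :
    ∃ W' : Fin r → Finset V, (∀ i, (W' i).Nonempty) ∧ (∀ i, W' i ⊆ W i) ∧
      (∀ i, ε ^ 2 * ((W i).card : ℝ) ≤ (W' i).card) ∧
      boxPotential G c W + 2 * c * ε ^ 4 ≤ boxPotential G c W' := by
  unfold IsRegularBox at h
  push Not at h
  obtain ⟨i, j, hlt, hirr⟩ := h
  obtain ⟨X, hX, Y, hY, hXc, hYc, hdev⟩ := exists_small_witness G hε (hW i) (hW j) hirr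
  obtain ⟨s, t, hs, ht, hle⟩ := exists_cut_boxPotential G hε hc W hW hlt.ne hX hY
    (by rw [hXc]; exact Nat.le_ceil _) (by rw [hYc]; exact Nat.le_ceil _) hdev
  refine ⟨_, ?_, ?_, ?_, hle⟩
  all_goals intro k
  all_goals
    rcases eq_or_ne k j with rfl | hkj
    · rw [Function.update_self]
      first
      | exact ht
      | exact cut_subset hY t
      | exact sq_mul_card_le_card_cut hε hε2 hY hYc t ht
    · rw [Function.update_of_ne hkj]
      rcases eq_or_ne k i with rfl | hki
      · rw [Function.update_self]
        first
        | exact hs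
        | exact cut_subset hX s
        | exact sq_mul_card_le_card_cut hε hε2 hX hXc s hs
      · have hk : Function.update W i (cut (W i) X s) k = W k := Function.update_of_ne hki _ _
        first
        | exact hk ▸ hW k
        | exact hk.subset
        | rw [hk]
          exact mul_le_of_le_one_left (by positivity) (by nlinarith)

theorem exists_regular_subbox_or {V : Type*} [DecidableEq V] (G : SimpleGraph V)
    [DecidableRel G.Adj] {ε c : ℝ} (hε : 0 < ε) (hε2 : ε ≤ 1 / 2) (hc : 0 ≤ c) {r : ℕ}
    (W : Fin r → Finset V) (hW : ∀ i, (W i).Nonempty) (N : ℕ) :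
    ∃ W' : Fin r → Finset V, (∀ i, (W' i).Nonempty) ∧ (∀ i, W' i ⊆ W i) ∧
      (∀ i, (ε ^ 2) ^ N * ((W i).card : ℝ) ≤ (W' i).card) ∧
      boxPotential G c W ≤ boxPotential G c W' ∧
      (IsRegularBox G ε W' ∨
        boxPotential G c W + N * (2 * c * ε ^ 4) ≤ boxPotential G c W') := by
  induction N with
  | zero => exact ⟨W, hW, fun _ => subset_rfl, fun i => by simp, le_rfl, Or.inr (by simp)⟩
  | succ N ih =>
    obtain ⟨W', h1, h2, h3, h4, h5⟩ := ih
    have hsq : ε ^ 2 ≤ 1 := by nlinarith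
    by_cases hreg : IsRegularBox G ε W'
    · refine ⟨W', h1, h2, fun i => le_trans ?_ (h3 i), h4, Or.inl hreg⟩
      gcongr ?_ * _
      exact pow_le_pow_of_le_one (by positivity) hsq N.le_succ
    · obtain ⟨W'', g1, g2, g3, g4⟩ := exists_subbox_of_not_regular G hε hε2 hc W' h1 hreg
      have hpos : 0 ≤ 2 * c * ε ^ 4 := by positivity
      refine ⟨W'', g1, fun i => (g2 i).trans (h2 i), fun i => le_trans ?_ (g3 i), by linarith,
        Or.inr ?_⟩
      · rw [pow_succ', mul_assoc]
        exact mul_le_mul_of_nonneg_left (h3 i) (by positivity)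
      · have := h5.resolve_left hreg
        push_cast
        linarith

theorem pairMean_adjInd_mem {V : Type*} (G : SimpleGraph V) [DecidableRel G.Adj]
    (A B : Finset V) : 0 ≤ pairMean (adjInd G) A B ∧ pairMean (adjInd G) A B ≤ 1 := by
  rw [← edgeDensity_eq_pairMean]
  exact ⟨by exact_mod_cast G.edgeDensity_nonneg A B, by exact_mod_cast G.edgeDensity_le_one A B⟩

/-! ### Bounds for the potential and for graph densities. -/

theorem card_offDiag_univ (r : ℕ) :
    ((Finset.univ : Finset (Fin r)).offDiag.card : ℝ) = r * (r - 1) := by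
  rw [Finset.offDiag_card, Finset.card_univ, Fintype.card_fin, Nat.cast_sub (Nat.le_mul_self r)]
  push_cast
  ring

theorem boxPotential_le {V : Type*} (G : SimpleGraph V) [DecidableRel G.Adj] {c : ℝ} (hc : 0 ≤ c)
    {r : ℕ} (W : Fin r → Finset V) :
    boxPotential G c W ≤ (∑ e ∈ (Finset.univ : Finset (Fin r)).offDiag,
      pairMean (adjInd G) (W e.1) (W e.2)) + r * (r - 1) * c := by
  unfold boxPotential
  rw [Finset.sum_add_distrib, ← card_offDiag_univ, ← nsmul_eq_mul]
  gcongr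
  refine Finset.sum_le_card_nsmul _ _ _ fun e _ => ?_
  obtain ⟨h0, h1⟩ := pairMean_adjInd_mem G (W e.1) (W e.2)
  exact mul_le_of_le_one_right hc (pow_le_one₀ h0 h1)

theorem sum_pairMean_le {V : Type*} (G : SimpleGraph V) [DecidableRel G.Adj]
    {r : ℕ} (W : Fin r → Finset V) :
    ∑ e ∈ (Finset.univ : Finset (Fin r)).offDiag, pairMean (adjInd G) (W e.1) (W e.2)
      ≤ r * (r - 1) := by
  rw [← card_offDiag_univ, ← mul_one (Finset.card _ : ℝ), ← nsmul_eq_mul]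
  exact Finset.sum_le_card_nsmul _ _ _ fun e _ => (pairMean_adjInd_mem G (W e.1) (W e.2)).2

/-- The density of a graph in terms of ordered pairs. -/
theorem graphDensity_eq {V : Type*} [Fintype V] (G : SimpleGraph V) [DecidableRel G.Adj] :
    graphDensity G = (∑ u, ∑ v, adjInd G u v) /
      ((Fintype.card V : ℝ) * ((Fintype.card V : ℝ) - 1)) := by
  classical
  have h := G.sum_degrees_eq_twice_card_edges
  have hS : ∑ u, ∑ v, adjInd G u v = 2 * (G.edgeFinset.card : ℝ) := by
    rw [← Nat.cast_ofNat, ← Nat.cast_mul, ← h, Nat.cast_sum]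
    refine Finset.sum_congr rfl fun u _ => ?_
    unfold adjInd
    rw [Finset.sum_boole, ← G.card_neighborFinset_eq_degree, G.neighborFinset_eq_filter]
  have hE : G.edgeSet.ncard = G.edgeFinset.card := by
    rw [← SimpleGraph.coe_edgeFinset, Set.ncard_coe_finset]
  unfold graphDensity
  rw [hS, hE, Nat.cast_choose_two, div_div_eq_mul_div, mul_comm]

theorem sum_adjInd_eq_offDiag {V : Type*} [Fintype V] [DecidableEq V] (G : SimpleGraph V)
    [DecidableRel G.Adj] :
    ∑ u, ∑ v, adjInd G u v = ∑ e ∈ (Finset.univ : Finset V).offDiag, adjInd G e.1 e.2 := by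
  rw [← Fintype.sum_prod_type']
  symm
  refine Finset.sum_subset (Finset.subset_univ _) fun e _ he => ?_
  have : e.1 = e.2 := by simpa using he
  simp [adjInd, this]

theorem graphDensity_le_one {V : Type*} [Fintype V] (G : SimpleGraph V) [DecidableRel G.Adj] :
    graphDensity G ≤ 1 := by
  classical
  rw [graphDensity_eq, sum_adjInd_eq_offDiag]
  have hc : ((Finset.univ : Finset V).offDiag.card : ℝ)
      = (Fintype.card V : ℝ) * ((Fintype.card V : ℝ) - 1) := by
    rw [Finset.offDiag_card, Finset.card_univ, Nat.cast_sub (Nat.le_mul_self _)]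
    push_cast
    ring
  rw [← hc]
  refine div_le_one_of_le₀ ?_ (by positivity)
  rw [← mul_one (Finset.card _ : ℝ), ← nsmul_eq_mul]
  refine Finset.sum_le_card_nsmul _ _ _ fun e _ => ?_
  unfold adjInd
  split_ifs <;> norm_num

/-! ### The initial box, by averaging over permutations. -/

theorem exists_perm_two {V : Type*} [DecidableEq V] {a b a' b' : V} (h : a ≠ b) (h' : a' ≠ b') :
    ∃ σ : Equiv.Perm V, σ a = a' ∧ σ b = b' := by
  refine ⟨Equiv.swap (Equiv.swap a a' b) b' * Equiv.swap a a', ?_, by simp⟩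
  have h1 : Equiv.swap a a' b ≠ a' := by
    intro hb
    rw [Equiv.swap_apply_eq_iff, Equiv.swap_apply_right] at hb
    exact h hb.symm
  simp [Equiv.swap_apply_of_ne_of_ne h1.symm h']

/-- Permutations act transitively on ordered pairs of distinct vertices, so the sum is the same for
every such pair; averaging over all pairs gives the density. -/
theorem sum_perm_adjInd {V : Type*} [Fintype V] [DecidableEq V] (G : SimpleGraph V)
    [DecidableRel G.Adj] {a b : V} (h : a ≠ b) :
    ∑ π : Equiv.Perm V, adjInd G (π a) (π b)
      = (Fintype.card (Equiv.Perm V) : ℝ) * graphDensity G := by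
  have hconst : ∀ e ∈ (Finset.univ : Finset V).offDiag,
      ∑ π : Equiv.Perm V, adjInd G (π e.1) (π e.2) = ∑ π : Equiv.Perm V, adjInd G (π a) (π b) := by
    intro e he
    obtain ⟨σ, h1, h2⟩ := exists_perm_two h (Finset.mem_offDiag.mp he).2.2
    rw [← Equiv.sum_comp (Equiv.mulRight σ) (fun π : Equiv.Perm V => adjInd G (π a) (π b))]
    simp [h1, h2]
  have hsum := Finset.sum_congr rfl hconst
  rw [Finset.sum_const, nsmul_eq_mul, Finset.sum_comm] at hsum
  have hinner : ∀ π : Equiv.Perm V,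
      ∑ e ∈ (Finset.univ : Finset V).offDiag, adjInd G (π e.1) (π e.2)
        = ∑ u, ∑ v, adjInd G u v := by
    intro π
    rw [← Equiv.sum_comp π (fun u => ∑ v, adjInd G u v)]
    simp_rw [← Equiv.sum_comp π (fun v => adjInd G _ v)]
    rw [← Fintype.sum_prod_type']
    refine Finset.sum_subset (Finset.subset_univ _) fun e _ he => ?_
    have : e.1 = e.2 := by simpa using he
    simp [adjInd, this]
  rw [Finset.sum_congr rfl fun π _ => hinner π, Finset.sum_const, nsmul_eq_mul,
    Finset.card_univ, Finset.offDiag_card, Finset.card_univ,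
    Nat.cast_sub (Nat.le_mul_self _)] at hsum
  have hcard : 1 < Fintype.card V := Fintype.one_lt_card_iff.mpr ⟨a, b, h⟩
  have hcR : (1 : ℝ) < Fintype.card V := by exact_mod_cast hcard
  have hne : (Fintype.card V : ℝ) * ((Fintype.card V : ℝ) - 1) ≠ 0 :=
    mul_ne_zero (by linarith) (by linarith)
  rw [graphDensity_eq, ← mul_div_assoc, eq_div_iff hne, hsum]
  push_cast
  ring

theorem exists_disjoint_sets {V : Type*} [Fintype V] {r m : ℕ}
    (h : r * m ≤ Fintype.card V) :
    ∃ W : Fin r → Finset V, (∀ i j, i ≠ j → Disjoint (W i) (W j)) ∧ ∀ i, (W i).card = m := by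
  classical
  obtain ⟨g⟩ : Nonempty (Fin r × Fin m ↪ V) :=
    Function.Embedding.nonempty_of_card_le (by simpa using h)
  refine ⟨fun i => Finset.univ.map ⟨fun k => g (i, k), fun k l hkl => by simpa using hkl⟩, ?_,
    fun i => by simp⟩
  intro i j hij
  rw [Finset.disjoint_left]
  intro x hx hy
  simp only [Finset.mem_map, Finset.mem_univ, true_and] at hx hy
  obtain ⟨k, rfl⟩ := hx
  obtain ⟨l, hl⟩ := hy
  exact hij (by simpa using (congrArg Prod.fst (g.injective hl)).symm)

theorem exists_box_le_sum_pairMean {V : Type*} [Fintype V] (G : SimpleGraph V) [DecidableRel G.Adj]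
    {r m : ℕ} (hm : 1 ≤ m) (h : r * m ≤ Fintype.card V) :
    ∃ W : Fin r → Finset V, (∀ i j, i ≠ j → Disjoint (W i) (W j)) ∧ (∀ i, (W i).card = m) ∧
      r * (r - 1) * graphDensity G ≤
        ∑ e ∈ (Finset.univ : Finset (Fin r)).offDiag, pairMean (adjInd G) (W e.1) (W e.2) := by
  classical
  obtain ⟨W, hdis, hcard⟩ := exists_disjoint_sets h
  have hmR : (m : ℝ) ≠ 0 := by exact_mod_cast (by omega : m ≠ 0)
  set U : Equiv.Perm V → Fin r → Finset V := fun π i => (W i).map π.toEmbedding with hU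
  have hmean : ∑ π, ∑ e ∈ (Finset.univ : Finset (Fin r)).offDiag,
      pairMean (adjInd G) (U π e.1) (U π e.2)
        = ∑ π : Equiv.Perm V, r * (r - 1) * graphDensity G := by
    rw [Finset.sum_comm, Finset.sum_const, Finset.card_univ, nsmul_eq_mul, ← card_offDiag_univ,
      mul_left_comm, ← nsmul_eq_mul]
    refine Finset.sum_eq_card_nsmul fun e he => ?_
    have hne : e.1 ≠ e.2 := (Finset.mem_offDiag.mp he).2.2
    simp only [pairMean, hU, Finset.card_map, hcard, Finset.sum_map, Equiv.coe_toEmbedding]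
    rw [← Finset.sum_div, Finset.sum_comm]
    rw [div_eq_iff (mul_ne_zero hmR hmR)]
    have h1 : ∀ a ∈ W e.1, ∑ π : Equiv.Perm V, ∑ b ∈ W e.2, adjInd G (π a) (π b)
        = m * ((Fintype.card (Equiv.Perm V) : ℝ) * graphDensity G) := by
      intro a ha
      rw [Finset.sum_comm, ← hcard e.2, ← nsmul_eq_mul]
      refine Finset.sum_eq_card_nsmul fun b hb => sum_perm_adjInd G ?_
      rintro rfl
      exact Finset.disjoint_left.mp (hdis _ _ hne) ha hb
    rw [Finset.sum_congr rfl h1, Finset.sum_const, hcard, nsmul_eq_mul]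
    ring
  obtain ⟨π, -, hπ⟩ := Finset.exists_le_of_sum_le Finset.univ_nonempty hmean.ge
  refine ⟨U π, fun i j hij => ?_, fun i => by simp [hU, hcard], hπ⟩
  exact (Finset.disjoint_map _).mpr (hdis i j hij)

/-! ### The reduced graph. -/

/-- An adjacent pair has density at most 1 and any other less than `δ`; if `R` has density `y`, the
average is at most `y + (1 - y)δ`, which increases with `y`. -/
theorem graphDensity_reducedGraph_ge {V : Type*} (G : SimpleGraph V) [DecidableRel G.Adj]
    {r : ℕ} (hr : 2 ≤ r) (W : Fin r → Finset V) {δ x : ℝ}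
    (h : r * (r - 1) * (x + (1 - x) * δ) ≤
      ∑ e ∈ (Finset.univ : Finset (Fin r)).offDiag, pairMean (adjInd G) (W e.1) (W e.2))
    (hδ1 : δ < 1) : x ≤ graphDensity (reducedGraph G W δ) := by
  classical
  have hrR : (2 : ℝ) ≤ r := by exact_mod_cast hr
  have hpos : (0 : ℝ) < r * (r - 1) := mul_pos (by linarith) (by linarith)
  have hle : ∑ e ∈ (Finset.univ : Finset (Fin r)).offDiag, pairMean (adjInd G) (W e.1) (W e.2)
      ≤ ∑ e ∈ (Finset.univ : Finset (Fin r)).offDiag,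
        ((1 - δ) * adjInd (reducedGraph G W δ) e.1 e.2 + δ) := by
    refine Finset.sum_le_sum fun e he => ?_
    have hne : e.1 ≠ e.2 := (Finset.mem_offDiag.mp he).2.2
    unfold adjInd
    split_ifs with hadj
    · have := (pairMean_adjInd_mem G (W e.1) (W e.2)).2
      unfold adjInd at this
      linarith
    · have : ¬ δ ≤ (G.edgeDensity (W e.1) (W e.2) : ℝ) := fun hd => hadj ⟨hne, hd⟩
      rw [edgeDensity_eq_pairMean] at this
      unfold adjInd at this
      linarith
  rw [Finset.sum_add_distrib, ← Finset.mul_sum, ← sum_adjInd_eq_offDiag, Finset.sum_const,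
    nsmul_eq_mul, card_offDiag_univ] at hle
  rw [graphDensity_eq, Fintype.card_fin, le_div_iff₀ hpos]
  have : (1 - δ) * (x * (r * (r - 1))) ≤ (1 - δ) * ∑ u, ∑ v, adjInd (reducedGraph G W δ) u v := by
    linarith
  exact le_of_mul_le_mul_left this (by linarith)

/-! ### Sizes of the sides and conclusion. -/

/-- Rounding `n/r` down loses at most a factor 2, paid for by one extra `ε ≤ 1/2`. -/
theorem pow_mul_le_floor {ε : ℝ} (hε : 0 < ε) (hε2 : ε ≤ 1 / 2) {n r N : ℕ} (hr : 1 ≤ r)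
    (hrn : r ≤ n) (hN : (N : ℝ) ≤ r * (r - 1) / (2 * ε ^ 5) + 1) :
    ε ^ ((r : ℝ) ^ 2 / ε ^ 5) * ((n : ℝ) / r) ≤ (ε ^ 2) ^ N * ((n / r : ℕ) : ℝ) := by
  have hrR : (1 : ℝ) ≤ r := by exact_mod_cast hr
  have hε5 : ε ^ 5 ≤ 1 / 32 := by
    calc ε ^ 5 ≤ (1 / 2) ^ 5 := by gcongr
      _ = 1 / 32 := by norm_num
  -- Since `r² = r(r-1) + r`, the term `r/ε⁵` must absorb the 3 in `2N + 1 ≤ r(r-1)/ε⁵ + 3`.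
  have hinv : 3 ≤ r / ε ^ 5 := by
    rw [le_div_iff₀ (by positivity)]
    linarith
  have hexp : ((2 * N + 1 : ℕ) : ℝ) ≤ (r : ℝ) ^ 2 / ε ^ 5 := by
    have h1 : (r : ℝ) ^ 2 / ε ^ 5 = 2 * (r * (r - 1) / (2 * ε ^ 5)) + r / ε ^ 5 := by
      field_simp
      ring
    push_cast
    linarith
  have h1 : ε ^ ((r : ℝ) ^ 2 / ε ^ 5) ≤ ε ^ (2 * N + 1) := by
    rw [← Real.rpow_natCast ε (2 * N + 1)]
    exact Real.rpow_le_rpow_of_exponent_ge hε (by linarith) hexp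
  have h2 : (n : ℝ) / r ≤ 2 * ((n / r : ℕ) : ℝ) := by
    rw [div_le_iff₀ (by linarith)]
    have hq : 1 ≤ n / r := Nat.div_pos hrn hr
    have hlt : n < r * (n / r) + r := by
      have := Nat.div_add_mod n r
      have := Nat.mod_lt n hr
      omega
    have : n ≤ 2 * (n / r) * r := by nlinarith
    exact_mod_cast this
  calc ε ^ ((r : ℝ) ^ 2 / ε ^ 5) * ((n : ℝ) / r)
      ≤ ε ^ (2 * N + 1) * (2 * ((n / r : ℕ) : ℝ)) := by gcongr
    _ = (ε ^ 2) ^ N * ((n / r : ℕ) : ℝ) * (2 * ε) := by rw [← pow_mul]; ring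
    _ ≤ (ε ^ 2) ^ N * ((n / r : ℕ) : ℝ) * 1 := by gcongr; linarith
    _ = _ := mul_one _

theorem lemma3 {V : Type*} [Fintype V] (G : SimpleGraph V) [DecidableRel G.Adj]
    (ε : ℝ) (hε : 0 < ε) (hεd : ε ≤ graphDensity G / 2)
    (r : ℕ) (hr : 1 ≤ r) (hrn : r ≤ Fintype.card V) :
    ∃ W : Fin r → Finset V,
      (∀ i j : Fin r, i ≠ j → Disjoint (W i) (W j)) ∧
      (∀ i : Fin r, ε ^ ((r : ℝ) ^ 2 / ε ^ 5) * ((Fintype.card V : ℝ) / (r : ℝ)) ≤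
        ((W i).card : ℝ)) ∧
      IsRegularBox G ε W ∧
      (2 ≤ r → graphDensity G / 4 ≤
        graphDensity (reducedGraph G W (graphDensity G / (4 - graphDensity G)))) := by
  classical
  have hd1 := graphDensity_le_one G
  set d := graphDensity G with hd
  have hε2 : ε ≤ 1 / 2 := by linarith
  have hd0 : 0 < d := by linarith
  have hrR : (1 : ℝ) ≤ r := by exact_mod_cast hr
  set K : ℝ := r * (r - 1) with hK
  have hK0 : 0 ≤ K := mul_nonneg (by linarith) (by linarith)
  obtain ⟨W₀, hdis, hcard, hsum⟩ := exists_box_le_sum_pairMean G (r := r)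
    (Nat.div_pos hrn hr) (Nat.mul_div_le (Fintype.card V) r)
  have hne : ∀ i, (W₀ i).Nonempty := fun i =>
    Finset.card_pos.mp (by rw [hcard]; exact Nat.div_pos hrn hr)
  set N := ⌊K / (2 * ε ^ 5)⌋₊ + 1 with hN
  have hNle : (N : ℝ) ≤ K / (2 * ε ^ 5) + 1 := by
    rw [hN]
    push_cast
    gcongr
    exact Nat.floor_le (by positivity)
  have hNlt : K / (2 * ε ^ 5) < N := by
    rw [hN]
    push_cast
    exact Nat.lt_floor_add_one _
  obtain ⟨W, -, hsub, hsize, hpot, hreg⟩ :=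
    exists_regular_subbox_or G hε hε2 (c := d / 2) (by linarith) W₀ hne N
  have hstart : K * d ≤ boxPotential G (d / 2) W₀ := by
    refine hsum.trans (Finset.sum_le_sum fun e _ => ?_)
    have : 0 ≤ d / 2 * pairMean (adjInd G) (W₀ e.1) (W₀ e.2) ^ 2 := by positivity
    linarith
  have hend := boxPotential_le G (c := d / 2) (by linarith) W
  rw [← hK] at hend
  refine ⟨W, fun i j hij => (hdis i j hij).mono (hsub i) (hsub j), fun i => ?_, ?_, fun hr2 => ?_⟩
  · refine le_trans ?_ (hsize i)
    rw [hcard]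
    exact pow_mul_le_floor hε hε2 hr hrn hNle
  · refine hreg.resolve_right fun hbig => ?_
    have hmax := sum_pairMean_le G W
    rw [← hK] at hmax
    have h1 : K < N * (2 * ε ^ 5) := (div_lt_iff₀ (by positivity)).mp hNlt
    -- The only use of `ε ≤ d/2` itself, rather than of `ε ≤ 1/2`, in bounding the number of steps.
    have h2 : N * (2 * ε ^ 5) ≤ N * (2 * (d / 2) * ε ^ 4) := by
      have : ε ^ 5 ≤ d / 2 * ε ^ 4 := by
        rw [pow_succ']
        gcongr
      have h3 : (0 : ℝ) ≤ N := by positivity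
      nlinarith
    have h3 : 0 ≤ K * d := by positivity
    linarith
  · refine graphDensity_reducedGraph_ge G hr2 W ?_ ?_
    · have h4 : (4 - d) ≠ 0 := by linarith
      -- The threshold `δ = d/(4-d)` solves `d/4 + (1 - d/4)δ = d/2`.
      have : d / 4 + (1 - d / 4) * (d / (4 - d)) = d / 2 := by
        field_simp
        ring
      rw [this, ← hK]
      linarith
    · rw [div_lt_one (by linarith)]
      linarith
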